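/- Let $G=(V,E)$ be a finite acyclic directed multigraph whose channels (edges) all have unit capacity, with one source node $s$ having no incoming channels and a set $T\subseteq V\setminus\{s\}$ of sink nodes having no outgoing channels; the nodes in $J=V\setminus(\{s\}\cup T)$ are called internal. For $t\in T$ let $C_t$ be the minimum cut capacity between $s$ and $t$. **Codes.** An $m$-dimensional linear network error correction code over a finite field $\mathbb F$ is a choice of local encoding coefficients $k_{d,e}\in\mathbb F$ for all pairs of channels with $e\in E$ and $d\in In(\mathrm{tail}(e))$, where $In(s)=\{d_1',\dots,d_m'\}$ consists of $m$ imaginary message channels; the matrix $K_i=[k_{d,e}]_{d\in In(i),\,e\in Out(i)}$ is the local encoding kernel at the node $i$. The extended global encoding kernels are the column vectors in $\mathbb F^{m+|E|}$, indexed by $In(s)\cup E$, with $\tilde f_{d_i'}=1_{d_i'}$ and $\tilde f_e=\sum_{d\in In(\mathrm{tail}(e))}k_{d,e}\tilde f_d+1_e$ for $e\in E$, where $1_d$ is the indicator vector of $d$. For $t\in T$ write $[\tilde f_e: e\in In(t)]=\begin{bmatrix}F_t\\ G_t\end{bmatrix}$, where $F_t$ has $m$ rows and $G_t$ has $|E|$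 rows, and put $\Phi(t)=\{X F_t: X\in\mathbb F^m\}$ and, for $\rho\subseteq E$, $\Delta(t,\rho)=\{ZG_t: Z\in\mathbb F^{E},\ Z_e=0\text{ for } e\notin\rho\}$. Let $\mathrm{rank}_t(\rho)$ be the least $|\rho'|$ over all $\rho'\subseteq E$ such that $\Delta(t,\rho)\subseteq\Delta(t,\rho')$ for every linear network code over $\mathbb F$ on $G$. The code is a network MDS code if, for all $t\in T$, $\dim\Phi(t)=m$ and $$d_{\min}^{(t)}:=\min\{\mathrm{rank}_t(\rho):\ \Delta(t,\rho)\cap\Phi(t)\neq\{0\}\}=C_t-m+1 .$$ A family of variable-rate network MDS codes of dimensions $1,\dots,\omega$ consists of network MDS codes $\mathbf C_1,\dots,\mathbf C_\omega$ on $G$ over $\mathbb F$, $\mathbf C_m$ being $m$-dimensional, that have the same local encoding kernel at each internal node. **Random method.** Choose all local encoding coefficients of an $\omega$-dimensional code $\mathbf C_\omega$ independently and uniformly in $\mathbb F$. For $m=\omega-1,\omega-2,\dots,1$ choose a vector $\vec k^{(m)}\in\mathbb F^m$ uniformly, independently of all other choices, and let $\mathbf C_m$ be the code with the same local encoding kernels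 as $\mathbf C_{m+1}$ at all non-source nodes and with the kernel $K_s^{(m)}=[\,I_m\ \ \vec k^{(m)}\,]\,K_s^{(m+1)}$ at the source. **Statement.** Let $1\le\omega\le\min_{t\in T}C_t$. For every $\varepsilon>0$ there is an integer $q_0$, depending only on $G$, $\omega$ and $\varepsilon$, such that for every finite field $\mathbb F$ with $|\mathbb F|\ge q_0$ the codes $\mathbf C_1,\dots,\mathbf C_\omega$ produced by the random method over $\mathbb F$ form a family of variable-rate network MDS codes of dimensions $1,\dots,\omega$ with probability at least $1-\varepsilon$. -/

import Mathlib

universe u v w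

/-- A single source multicast network: a directed acyclic multigraph with node type `V` and channel
type `E` (parallel channels allowed, every channel of unit capacity), a source node without
incoming channels and a set of sink nodes without outgoing channels. -/
structure Network (V : Type u) (E : Type v) where
  tail : E → V
  head : E → V
  source : V
  sinks : Finset V
  acyclic : ∀ i : V, ¬ Relation.TransGen (fun a b => ∃ e, tail e = a ∧ head e = b) i i
  head_ne_source : ∀ e, head e ≠ source
  tail_notMem_sinks : ∀ e, tail e ∉ sinks
  source_notMem_sinks : source ∉ sinks

namespace Network

variable {V : Type u} {E : Type v} (G : Network V E)

/-- The (real) incoming channels of a node. -/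
abbrev In (i : V) : Type v := {e : E // G.head e = i}

/-- The outgoing channels of a node. -/
abbrev Out (i : V) : Type v := {e : E // G.tail e = i}

/-- The set of channels `A` is a cut between `i` and `j`: once the channels in `A` are removed there
is no directed path from `i` to `j`. -/
def IsCut (i j : V) (A : Finset E) : Prop :=
  ¬ Relation.ReflTransGen (fun a b => ∃ e, e ∉ A ∧ G.tail e = a ∧ G.head e = b) i j

/-- The minimum cut capacity between `i` and `j`. -/
noncomputable def minCut (i j : V) : ℕ := sInf {c | ∃ A : Finset E, G.IsCut i j A ∧ A.card = c}

/-- The channel `d` immediately precedes the channel `e`. -/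
def Precedes (d e : E) : Prop := G.head d = G.tail e

theorem transGen_of_precedes {d e : E} (h : Relation.TransGen G.Precedes d e) :
    Relation.TransGen (fun a b => ∃ e, G.tail e = a ∧ G.head e = b) (G.tail d) (G.tail e) := by
  induction h with
  | single h => exact .single ⟨d, rfl, h⟩
  | tail _ h ih => exact ih.tail ⟨_, rfl, h⟩

theorem wellFounded_precedes [Finite E] : WellFounded G.Precedes := by
  have : Std.Irrefl (Relation.TransGen G.Precedes) :=
    ⟨fun e h => G.acyclic _ (G.transGen_of_precedes h)⟩
  exact Subrelation.wf (fun h => Relation.TransGen.single h)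
    (Finite.wellFounded_of_trans_of_irrefl (Relation.TransGen G.Precedes))

/-- The local description of an `m`-dimensional `F`-valued linear network error correction code.
`sourceKernel` is the local encoding kernel at the source, its rows being indexed by the `m`
imaginary message channels; `kernel i` is the local encoding kernel at the node `i`. (The matrix
`kernel i` has no rows if `i` is the source, and no columns if `i` is a sink, so `kernel` carries
information at internal nodes only.) -/
@[ext]
structure Code (F : Type w) (m : ℕ) where
  sourceKernel : Matrix (Fin m) (G.Out G.source) F
  kernel : ∀ i : V, Matrix (G.In i) (G.Out i) F

namespace Code

variable {G} {F : Type w} [Field F] {m : ℕ}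

section Kernels

variable [Fintype E] (C : G.Code F m)

open scoped Classical in
/-- The extended global encoding kernel of every channel `e`, a vector indexed by the `m` imaginary
message channels and by `E`, through the recursion
`f e = ∑ d ∈ In (tail e), k d e • f d + 1_e`, where `In source` is the set of imaginary message
channels, whose kernels are the corresponding indicator vectors. -/
noncomputable def extKernel : E → (Fin m ⊕ E → F) :=
  G.wellFounded_precedes.fix fun e f =>
    (if h : G.tail e = G.source then
      ∑ i : Fin m, C.sourceKernel i ⟨e, h⟩ • (Pi.single (Sum.inl i) 1 : Fin m ⊕ E → F)
     else 0)
    + ∑ d : G.In (G.tail e), C.kernel (G.tail e) d ⟨e, rfl⟩ • f d.1 d.2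
    + Pi.single (Sum.inr e) 1

open scoped Classical in
theorem extKernel_eq (e : E) :
    C.extKernel e =
      (if h : G.tail e = G.source then
        ∑ i : Fin m, C.sourceKernel i ⟨e, h⟩ • (Pi.single (Sum.inl i) 1 : Fin m ⊕ E → F)
       else 0)
      + ∑ d : G.In (G.tail e), C.kernel (G.tail e) d ⟨e, rfl⟩ • C.extKernel d.1
      + Pi.single (Sum.inr e) 1 := by
  unfold extKernel
  rw [WellFounded.fix_eq]

/-- The decoding matrix at the node `t`, whose columns are the extended global encoding kernels of
the incoming channels of `t`. -/
noncomputable def decodingMatrix (t : V) : Matrix (Fin m ⊕ E) (G.In t) F :=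
  Matrix.of fun d e => C.extKernel e.1 d

/-- The rows of the decoding matrix indexed by the imaginary message channels. -/
noncomputable def messageMatrix (t : V) : Matrix (Fin m) (G.In t) F :=
  (C.decodingMatrix t).submatrix Sum.inl id

/-- The rows of the decoding matrix indexed by the channels of the network. -/
noncomputable def errorMatrix (t : V) : Matrix E (G.In t) F :=
  (C.decodingMatrix t).submatrix Sum.inr id

/-- The message space at `t`. -/
noncomputable def messageSpace (t : V) : Submodule F (G.In t → F) :=
  LinearMap.range (C.messageMatrix t).vecMulLinear

end Kernels

/-- The error message vectors matching the error pattern `ρ`. -/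
def matching (F : Type w) [Field F] (ρ : Finset E) : Submodule F (E → F) where
  carrier := {Z | ∀ e ∉ ρ, Z e = 0}
  add_mem' := fun ha hb e he => by simp [ha e he, hb e he]
  zero_mem' := fun _ _ => rfl
  smul_mem' := fun c Z hZ e he => by simp [hZ e he]

/-- The error space of the error pattern `ρ` at `t`. -/
noncomputable def errorSpace [Fintype E] (C : G.Code F m) (t : V) (ρ : Finset E) :
    Submodule F (G.In t → F) :=
  (matching F ρ).map (C.errorMatrix t).vecMulLinear

end Code

/-- The error pattern `ρ₁` is dominated by `ρ₂` with respect to `t`: for every linear network code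
over `F`, of any dimension, the error space of `ρ₁` is contained in that of `ρ₂`. -/
def Dominated [Fintype E] (F : Type w) [Field F] (t : V) (ρ₁ ρ₂ : Finset E) : Prop :=
  ∀ (m : ℕ) (C : G.Code F m), C.errorSpace t ρ₁ ≤ C.errorSpace t ρ₂

/-- The rank of an error pattern with respect to `t`. -/
noncomputable def patternRank [Fintype E] (F : Type w) [Field F] (t : V) (ρ : Finset E) : ℕ :=
  sInf {c | ∃ ρ' : Finset E, G.Dominated F t ρ ρ' ∧ ρ'.card = c}

namespace Code

variable {G} {F : Type w} [Field F] {m : ℕ}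

/-- A code is regular if its message space has full dimension at every sink. -/
def IsRegular [Fintype E] (C : G.Code F m) : Prop :=
  ∀ t ∈ G.sinks, Module.finrank F (C.messageSpace t) = m

/-- The minimum distance of a code at `t`. -/
noncomputable def minDist [Fintype E] (C : G.Code F m) (t : V) : ℕ :=
  sInf {r | ∃ ρ : Finset E, C.errorSpace t ρ ⊓ C.messageSpace t ≠ ⊥ ∧ G.patternRank F t ρ = r}

/-- A network MDS code: a regular code that attains the refined Singleton bound
`minDist t ≤ C_t - m + 1` at every sink `t`, where `C_t` is the minimum cut capacity between the
source and `t`. -/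
def IsMDS [Fintype E] (C : G.Code F m) : Prop :=
  C.IsRegular ∧ ∀ t ∈ G.sinks, C.minDist t + m = G.minCut G.source t + 1

/-- The `m`-dimensional code obtained from an `(m + 1)`-dimensional one and a vector `k`, by
multiplying the kernel at the source from the left by the matrix `[I k]`. The kernels at all other
nodes are kept. -/
def reduce (C : G.Code F (m + 1)) (k : Fin m → F) : G.Code F m where
  sourceKernel := Matrix.of fun i e =>
    C.sourceKernel i.castSucc e + k i * C.sourceKernel (Fin.last m) e
  kernel := C.kernel

end Code

/-- A family of codes of dimensions `m ≤ n` is a family of variable-rate network MDS codes of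
dimensions `1, …, n`: all of these are network MDS codes, and they have the same local encoding
kernel at each internal node. -/
def IsVariableRateMDSFamily [Fintype E] {F : Type w} [Field F] {n : ℕ}
    (C : ∀ m : ℕ, m ≤ n → G.Code F m) : Prop :=
  (∀ (m : ℕ) (hm : m ≤ n), 1 ≤ m → (C m hm).IsMDS) ∧
  ∀ (m : ℕ) (hm : m ≤ n), 1 ≤ m → ∀ i : V, i ≠ G.source → i ∉ G.sinks →
    (C m hm).kernel i = (C n le_rfl).kernel i

/-- The random choices of the random method: all local encoding coefficients of an `n`-dimensional
code, and, for every `m < n`, a vector `k` in `F ^ m`. -/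
abbrev Sample (F : Type w) (n : ℕ) : Type (max u v w) :=
  (Matrix (Fin n) (G.Out G.source) F × ∀ i : V, Matrix (G.In i) (G.Out i) F) ×
    ∀ m : Fin n, Fin m → F

/-- The family of codes that the random method makes from its random choices: the `n`-dimensional
code has the chosen coefficients, and the `m`-dimensional code is made from the
`(m + 1)`-dimensional one by means of the chosen vector in `F ^ m`. -/
def randomFamily {F : Type w} [Field F] {n : ℕ} (x : G.Sample F n) (m : ℕ) (hm : m ≤ n) :
    G.Code F m :=
  Nat.decreasingInduction (motive := fun j _ => G.Code F j)
    (fun j hj C => C.reduce (x.2 ⟨j, hj⟩)) ⟨x.1.1, x.1.2⟩ hm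

/-- The success probability of the random method, when all choices are independent and uniformly
distributed, that is, when the sample is uniformly distributed. -/
noncomputable def successProb [Fintype E] (F : Type w) [Field F] (n : ℕ) : ℝ :=
  ({x : G.Sample F n | G.IsVariableRateMDSFamily (G.randomFamily x)}.ncard : ℝ) /
    (Nat.card (G.Sample F n) : ℝ)

end Network

/-! ### Channel orders, blocking sets and cuts -/

namespace Network

variable {V : Type u} {E : Type v} (G : Network V E)

/-! Fix a sink `t` and study the response at `t` to a unit injected on one channel, message or real.
Messages and errors then play the same role: message spaces and error spaces are spans of responses.
Summing over paths by their first step shows that the response to `a` is its own indicator at `t`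
plus a combination of the responses to the successors of `a`, with the local coefficients as
weights.

Call a code generic if a response can lie in the span of later responses only when the responses to
all its successors do. For generic codes max-flow equals min-cut in linear form
(`IsGeneric.exists_blocked`): sweeping a set `P` of channels in topological order, a channel with
independent response joins the blocking set, and a dependent one is replaced by its successors
without enlarging the span. Applied to all messages together with an error pattern of size at most
`C_t - m`, this forces the message space to have full dimension and to meet the error space
trivially (`IsGeneric.independent`). With the Singleton bound this makes every generic code MDS.

It remains to see that a random code is generic. If genericity fails at `(a, Q, e)`, varying only
the coefficient from `a` to `e` moves the response to `a` along the response to `e`, which lies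
outside the fixed span of `Q`; so at most one value of the coefficient is bad, and the failure has
probability at most `1 / |F|`. This also works for the derived codes, since `[I k]` passes a change
in one of the first `m` source rows on unaltered. A union bound over finitely many places, their
number independent of `F`, concludes. -/

theorem exists_topologicalOrder [Finite E] :
    ∃ l : E → ℕ, Function.Injective l ∧ ∀ d e, G.Precedes d e → l d < l e := by
  obtain ⟨k, ⟨enum⟩⟩ := Finite.exists_equiv_fin E
  let c : E → ℕ := fun e => {d | Relation.TransGen G.Precedes d e}.ncard
  have hc : ∀ d e, G.Precedes d e → c d < c e := fun d e h => by
    refine Set.ncard_lt_ncard ⟨fun x hx => Relation.TransGen.tail hx h, fun hsub => ?_⟩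
      (Set.toFinite _)
    exact G.acyclic _ (G.transGen_of_precedes (hsub (Relation.TransGen.single h)))
  -- Order by the number of ancestors, with ties broken by the enumeration: since `enum e < k`, the
  -- value mod `k` recovers `e`.
  refine ⟨fun e => c e * k + enum e, fun d e h => ?_, fun d e h => ?_⟩
  · have h' : c d * k + enum d = c e * k + enum e := h
    have h1 := congrArg (· % k) h'
    simp only [Nat.mul_add_mod_self_right, Nat.mod_eq_of_lt (enum _).2] at h1
    exact enum.injective (Fin.ext h1)
  · have h1 : (c d + 1) * k ≤ c e * k := Nat.mul_le_mul_right _ (hc d e h)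
    have h2 := (enum d).2
    change c d * k + enum d < c e * k + enum e
    rw [add_mul, one_mul] at h1
    omega

/-- A numbering of the channels that is compatible with the direction of the network. -/
noncomputable def channelOrder [Finite E] : E → ℕ := G.exists_topologicalOrder.choose

theorem channelOrder_injective [Finite E] : Function.Injective G.channelOrder :=
  G.exists_topologicalOrder.choose_spec.1

theorem channelOrder_lt [Finite E] {d e : E} (h : G.Precedes d e) :
    G.channelOrder d < G.channelOrder e :=
  G.exists_topologicalOrder.choose_spec.2 d e h

/-- A numbering of the message channels and the channels, compatible with the direction of the
network. -/
noncomputable def order [Finite E] (m : ℕ) : Fin m ⊕ E → ℕ :=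
  Sum.elim (fun i => i) fun e => m + G.channelOrder e

theorem order_injective [Finite E] (m : ℕ) : Function.Injective (G.order m) := by
  rintro (i | d) (j | e) h
  · exact congrArg _ (Fin.ext h)
  · have h' : (i : ℕ) = m + G.channelOrder e := h
    have := i.2
    omega
  · have h' : m + G.channelOrder d = j := h
    have := j.2
    omega
  · exact congrArg _ (G.channelOrder_injective (Nat.add_left_cancel h))

/-- The channel `e` immediately succeeds `a`, which is a message channel or a channel. -/
def Succeeds {m : ℕ} (a : Fin m ⊕ E) (e : E) : Prop :=
  Sum.elim (fun _ => G.tail e = G.source) (fun d => G.Precedes d e) a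

theorem order_lt [Finite E] {m : ℕ} {a : Fin m ⊕ E} {e : E} (h : G.Succeeds a e) :
    G.order m a < G.order m (Sum.inr e) := by
  rcases a with i | d
  · exact i.2.trans_le (Nat.le_add_right _ _)
  · exact Nat.add_lt_add_left (G.channelOrder_lt h) m

/-- Induction against the direction of the network. -/
theorem succeeds_induction [Finite E] {m : ℕ} {p : Fin m ⊕ E → Prop}
    (h : ∀ a, (∀ e, G.Succeeds a e → p (Sum.inr e)) → p a) (a : Fin m ⊕ E) : p a := by
  obtain ⟨L, hL⟩ := (Set.finite_range (G.order m)).bddAbove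
  have key : ∀ n a, L - G.order m a < n → p a := by
    intro n
    induction n with
    | zero => intro a ha; omega
    | succ n ih =>
      intro a ha
      refine h a fun e he => ih _ ?_
      have h1 := G.order_lt he
      have h2 : G.order m (Sum.inr e) ≤ L := hL ⟨_, rfl⟩
      omega
  exact key _ a (Nat.lt_succ_self _)

/-- Every path from `a` to `t` meets `A`. -/
inductive Blocked {m : ℕ} (t : V) (A : Finset (Fin m ⊕ E)) : Fin m ⊕ E → Prop
  | of_mem {a : Fin m ⊕ E} (h : a ∈ A) : Blocked t A a
  | of_succ {a : Fin m ⊕ E} (ht : ∀ e, a = Sum.inr e → G.head e ≠ t)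
      (h : ∀ e, G.Succeeds a e → Blocked t A (Sum.inr e)) : Blocked t A a

variable {G}

theorem Blocked.mono {m : ℕ} {t : V} {A B : Finset (Fin m ⊕ E)} (hAB : A ⊆ B)
    {a : Fin m ⊕ E} (h : G.Blocked t A a) : G.Blocked t B a := by
  induction h with
  | of_mem h => exact .of_mem (hAB h)
  | of_succ ht _ ih => exact .of_succ ht ih

/-- Successors are always real channels, so message channels in `A` do not help to block a real
channel. -/
theorem Blocked.toRight {m : ℕ} {t : V} {A : Finset (Fin m ⊕ E)} {a : Fin m ⊕ E}
    (h : G.Blocked t A a) (e : E) (ha : a = Sum.inr e) :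
    G.Blocked t (A.toRight.map ⟨Sum.inr, Sum.inr_injective⟩) (Sum.inr e : Fin m ⊕ E) := by
  induction h generalizing e with
  | of_mem h => subst ha; exact .of_mem (by simpa using h)
  | of_succ ht _ ih => subst ha; exact .of_succ ht fun e' he' => ih e' he' e' rfl

theorem Blocked.isCut {m : ℕ} {t : V} (ht : t ≠ G.source) {A : Finset (Fin m ⊕ E)} {i : Fin m}
    (h : G.Blocked t A (Sum.inl i)) (hi : Sum.inl i ∉ A) : G.IsCut G.source t A.toRight := by
  intro hpath
  -- Along a path that avoids `A`, blockedness can only come from `of_succ`, so it passes to every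
  -- next channel and the path never enters `t`.
  have key : ∀ j, Relation.ReflTransGen
      (fun a b => ∃ e, e ∉ A.toRight ∧ G.tail e = a ∧ G.head e = b) G.source j →
      j ≠ t ∧ ∀ e, G.tail e = j → G.Blocked t A (Sum.inr e) := by
    intro j hj
    induction hj with
    | refl =>
      cases h with
      | of_mem h => exact absurd h hi
      | of_succ _ h => exact ⟨ht.symm, fun e he => h e he⟩
    | tail _ hstep ih =>
      obtain ⟨e, heA, rfl, rfl⟩ := hstep
      have hb := ih.2 e rfl
      cases hb with
      | of_mem h => exact absurd (by simpa using h) heA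
      | of_succ h1 h2 => exact ⟨h1 e rfl, fun e' he' => h2 e' he'.symm⟩
  exact (key t hpath).1 rfl

theorem IsCut.blocked [Finite E] {t : V} {A : Finset E} (h : G.IsCut G.source t A) {m : ℕ}
    (i : Fin m) : G.Blocked t (A.map ⟨Sum.inr, Sum.inr_injective⟩) (Sum.inl i : Fin m ⊕ E) := by
  set R := fun a b => ∃ e, e ∉ A ∧ G.tail e = a ∧ G.head e = b with hR
  have key : ∀ a : Fin m ⊕ E, ∀ e, a = Sum.inr e → Relation.ReflTransGen R G.source (G.tail e) →
      G.Blocked t (A.map ⟨Sum.inr, Sum.inr_injective⟩) a := by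
    refine G.succeeds_induction fun a ih e hae hre => ?_
    subst hae
    by_cases heA : e ∈ A
    · exact .of_mem (by simpa using heA)
    · have hhead : Relation.ReflTransGen R G.source (G.head e) := hre.tail ⟨e, heA, rfl, rfl⟩
      refine .of_succ ?_ fun e' he' => ih e' he' e' rfl ?_
      · rintro _ h' rfl
        cases h'
        exact h hhead
      · have : G.head e = G.tail e' := he'
        rwa [← this]
  refine .of_succ (by simp) fun e he => key _ e rfl ?_
  have : G.tail e = G.source := he
  rw [this]

theorem minCut_le {i j : V} {A : Finset E} (h : G.IsCut i j A) : G.minCut i j ≤ A.card :=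
  Nat.sInf_le ⟨A, h, rfl⟩

/-- For `i = j` there is no cut and the infimum is the default value `0`; for distinct nodes the set
of all channels is a cut. -/
theorem exists_isCut_card_eq_minCut [Fintype E] {i j : V} (hij : i ≠ j) :
    ∃ A : Finset E, G.IsCut i j A ∧ A.card = G.minCut i j := by
  refine Nat.sInf_mem (s := {c | ∃ A : Finset E, G.IsCut i j A ∧ A.card = c})
    ⟨_, Finset.univ, fun h => ?_, rfl⟩
  rcases h.cases_head with h | ⟨_, ⟨e, he, _⟩, _⟩
  · exact hij h
  · exact he (Finset.mem_univ e)

end Network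

/-! ### Responses at a node to messages and errors -/

namespace Network

variable {V : Type u} {E : Type v} {G : Network V E}

namespace Code

variable {F : Type w} [Field F] {m : ℕ}

open scoped Classical in
/-- The local encoding coefficients, extended by zero to all pairs of channels. -/
noncomputable def coeff (C : G.Code F m) (a : Fin m ⊕ E) (e : E) : F :=
  Sum.elim (fun i => if h : G.tail e = G.source then C.sourceKernel i ⟨e, h⟩ else 0)
    (fun d => if h : G.head d = G.tail e then C.kernel (G.tail e) ⟨d, h⟩ ⟨e, rfl⟩ else 0) a

theorem coeff_eq_zero (C : G.Code F m) {a : Fin m ⊕ E} {e : E} (h : ¬ G.Succeeds a e) :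
    C.coeff a e = 0 := by
  rcases a with i | d
  · exact dif_neg h
  · exact dif_neg h

variable [Fintype E]

open scoped Classical in
theorem extKernel_apply (C : G.Code F m) (e : E) (a : Fin m ⊕ E) :
    C.extKernel e a = (if a = Sum.inr e then 1 else 0)
      + (Sum.elim (fun i => C.coeff (Sum.inl i) e) (fun _ => 0) a)
      + ∑ d, C.coeff (Sum.inr d) e * C.extKernel d a := by
  rw [extKernel_eq]
  have h1 : (if h : G.tail e = G.source then
        ∑ i : Fin m, C.sourceKernel i ⟨e, h⟩ • (Pi.single (Sum.inl i) 1 : Fin m ⊕ E → F)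
       else 0) a = Sum.elim (fun i => C.coeff (Sum.inl i) e) (fun _ => 0) a := by
    rcases a with i | d
    · by_cases h : G.tail e = G.source
      · simp [coeff, h, Pi.single_apply]
      · simp [coeff, h]
    · by_cases h : G.tail e = G.source
      · simp [h]
      · simp [h]
  have h2 : (∑ d : G.In (G.tail e), C.kernel (G.tail e) d ⟨e, rfl⟩ • C.extKernel d.1) a
      = ∑ d, C.coeff (Sum.inr d) e * C.extKernel d a := by
    rw [Finset.sum_apply]
    have : ∑ d, C.coeff (Sum.inr d) e * C.extKernel d a
        = ∑ d with G.head d = G.tail e, C.coeff (Sum.inr d) e * C.extKernel d a := by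
      rw [Finset.sum_filter_of_ne]
      intro d _ hd
      by_contra hne
      exact hd (by rw [C.coeff_eq_zero (a := Sum.inr d) hne, zero_mul])
    rw [this, ← Finset.sum_subtype_eq_sum_filter]
    simp only [Finset.subtype_univ]
    refine Finset.sum_congr (by congr!) fun d _ => ?_
    simp [coeff, d.2]
  rw [Pi.add_apply, Pi.add_apply, h1, h2, Pi.single_apply]
  ring

open scoped Classical in
-- The entry at `a` is the sum over all paths from `a` to `e` of the products of coefficients. The
-- defining recursion removes the last step of a path, this one the first; expanding each by the
-- other gives the same double sum.
theorem extKernel_apply_backward (C : G.Code F m) (e : E) (a : Fin m ⊕ E) :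
    C.extKernel e a = (if a = Sum.inr e then 1 else 0)
      + ∑ d, C.coeff a d * C.extKernel e (Sum.inr d) := by
  induction e using G.wellFounded_precedes.induction with
  | _ e ih =>
    have h1 : ∑ d, C.coeff (Sum.inr d) e * C.extKernel d a
        = Sum.elim (fun _ => 0) (fun d => C.coeff (Sum.inr d) e) a
          + ∑ d, ∑ e', C.coeff (Sum.inr d) e * (C.coeff a e' * C.extKernel d (Sum.inr e')) := by
      have h2 : ∑ d, C.coeff (Sum.inr d) e * C.extKernel d a
          = ∑ d, (C.coeff (Sum.inr d) e * (if a = Sum.inr d then 1 else 0)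
            + ∑ e', C.coeff (Sum.inr d) e * (C.coeff a e' * C.extKernel d (Sum.inr e'))) := by
        refine Finset.sum_congr rfl fun d _ => ?_
        by_cases hd : G.Precedes d e
        · rw [ih d hd, mul_add, Finset.mul_sum]
        · simp [C.coeff_eq_zero (a := Sum.inr d) hd]
      rw [h2, Finset.sum_add_distrib]
      congr 1
      rcases a with i | d <;> simp
    have h3 : ∑ d, C.coeff a d * C.extKernel e (Sum.inr d)
        = C.coeff a e
          + ∑ d, ∑ e', C.coeff a d * (C.coeff (Sum.inr e') e * C.extKernel e' (Sum.inr d)) := by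
      simp_rw [C.extKernel_apply e (Sum.inr _), mul_add, Finset.sum_add_distrib, Finset.mul_sum]
      simp
    rw [extKernel_apply, h1, h3, Finset.sum_comm]
    have h4 : C.coeff a e = Sum.elim (fun i => C.coeff (Sum.inl i) e) (fun _ => 0) a
        + Sum.elim (fun _ => 0) (fun d => C.coeff (Sum.inr d) e) a := by
      rcases a with i | d <;> simp
    have h5 : ∀ x y, C.coeff (Sum.inr y) e * (C.coeff a x * C.extKernel y (Sum.inr x))
      = C.coeff a x * (C.coeff (Sum.inr y) e * C.extKernel y (Sum.inr x)) := fun x y => by ring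
    simp_rw [h5]
    rw [h4]
    ring

/-- The response at `t` to a unit message or error on `a`. -/
noncomputable def response (C : G.Code F m) (t : V) (a : Fin m ⊕ E) : G.In t → F :=
  fun e => C.extKernel e.1 a

open scoped Classical in
theorem response_eq (C : G.Code F m) (t : V) (a : Fin m ⊕ E) :
    C.response t a = (fun e : G.In t => if a = Sum.inr e.1 then 1 else 0)
      + ∑ e, C.coeff a e • C.response t (Sum.inr e) := by
  ext e
  simp only [response, Pi.add_apply, Finset.sum_apply, Pi.smul_apply, smul_eq_mul]
  exact C.extKernel_apply_backward e.1 a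

/-- The span of the responses at `t` to the channels in `P`. -/
noncomputable def responseSpan (C : G.Code F m) (t : V) (P : Finset (Fin m ⊕ E)) :
    Submodule F (G.In t → F) :=
  Submodule.span F (C.response t '' P)

theorem response_mem (C : G.Code F m) (t : V) {P : Finset (Fin m ⊕ E)} {a : Fin m ⊕ E}
    (h : a ∈ P) : C.response t a ∈ C.responseSpan t P :=
  Submodule.subset_span ⟨a, h, rfl⟩

theorem responseSpan_le (C : G.Code F m) (t : V) {P : Finset (Fin m ⊕ E)}
    {W : Submodule F (G.In t → F)} (h : ∀ a ∈ P, C.response t a ∈ W) :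
    C.responseSpan t P ≤ W :=
  Submodule.span_le.2 (by rintro _ ⟨a, ha, rfl⟩; exact h a ha)

open scoped Classical in
theorem responseSpan_union (C : G.Code F m) (t : V) (P Q : Finset (Fin m ⊕ E)) :
    C.responseSpan t (P ∪ Q) = C.responseSpan t P ⊔ C.responseSpan t Q := by
  simp [responseSpan, Set.image_union, Submodule.span_union]

theorem finrank_responseSpan_le (C : G.Code F m) (t : V) (P : Finset (Fin m ⊕ E)) :
    Module.finrank F (C.responseSpan t P) ≤ P.card := by
  classical
  have h := finrank_span_finset_le_card (R := F) (P.image (C.response t))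
  rw [Finset.coe_image] at h
  exact h.trans Finset.card_image_le

theorem messageSpace_eq (C : G.Code F m) (t : V) :
    C.messageSpace t = C.responseSpan t (Finset.univ.map ⟨Sum.inl, Sum.inl_injective⟩) := by
  classical
  apply le_antisymm
  · rintro _ ⟨X, rfl⟩
    have h : (C.messageMatrix t).vecMulLinear X = ∑ i, X i • C.response t (Sum.inl i) := by
      ext x
      simp [Matrix.vecMul, dotProduct, messageMatrix, decodingMatrix, response]
    rw [h]
    exact Submodule.sum_mem _ fun i _ => Submodule.smul_mem _ _ (C.response_mem t (by simp))
  · refine C.responseSpan_le t fun a ha => ?_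
    obtain ⟨i, -, rfl⟩ := Finset.mem_map.1 ha
    refine ⟨Pi.single i 1, ?_⟩
    ext x
    simp [messageMatrix, decodingMatrix, response]

theorem errorSpace_eq (C : G.Code F m) (t : V) (ρ : Finset E) :
    C.errorSpace t ρ = C.responseSpan t (ρ.map ⟨Sum.inr, Sum.inr_injective⟩) := by
  classical
  apply le_antisymm
  · rintro _ ⟨Z, hZ, rfl⟩
    have h : (C.errorMatrix t).vecMulLinear Z = ∑ e, Z e • C.response t (Sum.inr e) := by
      ext x
      simp [Matrix.vecMul, dotProduct, errorMatrix, decodingMatrix, response]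
    rw [h]
    refine Submodule.sum_mem _ fun e _ => ?_
    by_cases he : e ∈ ρ
    · exact Submodule.smul_mem _ _ (C.response_mem t (by simpa using he))
    · rw [hZ e he, zero_smul]
      exact zero_mem _
  · refine C.responseSpan_le t fun a ha => ?_
    obtain ⟨e, he, rfl⟩ := Finset.mem_map.1 ha
    refine ⟨Pi.single e 1, fun e' he' => Pi.single_eq_of_ne (by rintro rfl; exact he' he) _, ?_⟩
    ext x
    simp [errorMatrix, decodingMatrix, response]

/-- A blocked channel outside `A` does not enter `t`, so its response is a combination of those of
its successors, which are blocked in turn. -/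
theorem response_mem_of_blocked (C : G.Code F m) {t : V} {A : Finset (Fin m ⊕ E)}
    {a : Fin m ⊕ E} (h : G.Blocked t A a) : C.response t a ∈ C.responseSpan t A := by
  classical
  induction h with
  | of_mem h => exact C.response_mem t h
  | @of_succ a ht _ ih =>
    rw [response_eq]
    refine add_mem ?_ (Submodule.sum_mem _ fun e _ => ?_)
    · convert zero_mem (C.responseSpan t A) using 1
      ext e
      exact if_neg fun h => ht e.1 h e.2
    · by_cases he : G.Succeeds a e
      · exact Submodule.smul_mem _ _ (ih e he)
      · rw [C.coeff_eq_zero he, zero_smul]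
        exact zero_mem _

/-- Paths starting at a channel later than `a` never pass through `a`. -/
theorem response_congr {C C' : G.Code F m} {a : Fin m ⊕ E}
    (h : ∀ b ≠ a, ∀ e, C'.coeff b e = C.coeff b e) (t : V) (b : Fin m ⊕ E)
    (hb : G.order m a < G.order m b) : C'.response t b = C.response t b := by
  classical
  induction b using G.succeeds_induction with
  | _ b ih =>
    rw [response_eq, C.response_eq]
    congr 1
    refine Finset.sum_congr rfl fun e _ => ?_
    rw [h b (by rintro rfl; exact lt_irrefl _ hb)]
    by_cases he : G.Succeeds b e
    · rw [ih e he (hb.trans (G.order_lt he))]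
    · rw [C.coeff_eq_zero he, zero_smul, zero_smul]

theorem response_apply_eq_zero (C : G.Code F m) {t : V} (d : G.In t) (b : Fin m ⊕ E)
    (hb : G.order m (Sum.inr d.1) < G.order m b) : C.response t b d = 0 := by
  classical
  induction b using G.succeeds_induction with
  | _ b ih =>
    rw [response_eq]
    have hne : b ≠ Sum.inr d.1 := by rintro rfl; exact lt_irrefl _ hb
    simp only [Pi.add_apply, hne, if_false, zero_add, Finset.sum_apply, Pi.smul_apply]
    refine Finset.sum_eq_zero fun e _ => ?_
    by_cases he : G.Succeeds b e
    · rw [ih e he (hb.trans (G.order_lt he)), smul_zero]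
    · rw [C.coeff_eq_zero he, zero_smul]

theorem response_apply_self (C : G.Code F m) {t : V} (ht : t ∈ G.sinks) (d : G.In t) :
    C.response t (Sum.inr d.1) d = 1 := by
  classical
  rw [response_eq]
  simp only [Pi.add_apply, if_true, Finset.sum_apply, Pi.smul_apply, add_eq_left]
  refine Finset.sum_eq_zero fun e _ => ?_
  rw [C.coeff_eq_zero, zero_smul]
  intro h
  have h' : G.head d.1 = G.tail e := h
  exact G.tail_notMem_sinks e (by rwa [← h', d.2])

/-! ### Generic codes: max-flow min-cut and the MDS property -/

/-- A response at `t` lies in the span of the responses to later channels only if all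
responses to its successors do. -/
def IsGeneric (C : G.Code F m) (t : V) : Prop :=
  ∀ (a : Fin m ⊕ E) (Q : Finset (Fin m ⊕ E)), (∀ b ∈ Q, G.order m a < G.order m b) →
    C.response t a ∈ C.responseSpan t Q →
    ∀ e, G.Succeeds a e → C.response t (Sum.inr e) ∈ C.responseSpan t Q

/-- A max-flow min-cut theorem for generic codes: the channels in `P` are separated from `t` by a
set of channels that has at most the dimension of the span of their responses at `t`. -/
theorem IsGeneric.exists_blocked {C : G.Code F m} {t : V} (hC : C.IsGeneric t)
    (ht : t ∈ G.sinks) (P : Finset (Fin m ⊕ E)) :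
    ∃ A : Finset (Fin m ⊕ E), (∀ a ∈ P, G.Blocked t A a) ∧
      A.card ≤ Module.finrank F (C.responseSpan t P) := by
  classical
  obtain ⟨L, hL⟩ := (Set.finite_range (G.order (E := E) m)).bddAbove
  -- The hypothesis says that `P` lies in the last `n` positions up to `L`; the channel at position
  -- `L - n`, if present in the inductive step, is the earliest in `P`.
  have key : ∀ n : ℕ, ∀ P : Finset (Fin m ⊕ E), (∀ a ∈ P, L < G.order m a + n) →
      ∃ A : Finset (Fin m ⊕ E), (∀ a ∈ P, G.Blocked t A a) ∧
        A.card ≤ Module.finrank F (C.responseSpan t P) := by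
    intro n
    induction n with
    | zero =>
      intro P hP
      refine ⟨∅, fun a ha => ?_, by simp⟩
      have h1 := hP a ha
      have h2 : G.order m a ≤ L := hL ⟨a, rfl⟩
      omega
    | succ n ih =>
      intro P hP
      by_cases hex : ∃ a ∈ P, G.order m a + n = L
      · obtain ⟨a, haP, ha⟩ := hex
        have hlt : ∀ b ∈ P.erase a, G.order m a < G.order m b := by
          intro b hb
          rw [Finset.mem_erase] at hb
          have h1 := hP b hb.2
          have h2 : G.order m b ≠ G.order m a := fun h => hb.1 (G.order_injective m h)
          omega
        have hP' : P = insert a (P.erase a) := (Finset.insert_erase haP).symm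
        by_cases hmem : C.response t a ∈ C.responseSpan t (P.erase a)
        -- A dependent `a` cannot enter `t`: its own coordinate of the response is `1`, while all
        -- later responses vanish there.
        · have hhead : ∀ e, a = Sum.inr e → G.head e ≠ t := by
            rintro e rfl he
            have h1 : C.responseSpan t (P.erase (Sum.inr e)) ≤
                LinearMap.ker (LinearMap.proj (R := F) (φ := fun _ : G.In t => F) ⟨e, he⟩) :=
              C.responseSpan_le t fun b hb => C.response_apply_eq_zero ⟨e, he⟩ b (hlt b hb)
            have h2 : C.response t (Sum.inr e) ⟨e, he⟩ = 0 := h1 hmem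
            rw [C.response_apply_self ht ⟨e, he⟩] at h2
            exact one_ne_zero h2
          -- Replace `a` by its successors: blocking these blocks `a`, and by genericity the span
          -- does not grow.
          set S := (Finset.univ.filter fun e => G.Succeeds a e).map
            ⟨(Sum.inr : E → Fin m ⊕ E), Sum.inr_injective⟩ with hS
          obtain ⟨A, hA, hcard⟩ := ih (P.erase a ∪ S) fun b hb => by
            rcases Finset.mem_union.1 hb with hb | hb
            · have := hlt b hb
              omega
            · obtain ⟨e, he, rfl⟩ := Finset.mem_map.1 hb
              have := G.order_lt (Finset.mem_filter.1 he).2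
              simp only [Function.Embedding.coeFn_mk]
              omega
          refine ⟨A, fun b hb => ?_, hcard.trans (Submodule.finrank_mono ?_)⟩
          · by_cases hba : b = a
            · subst hba
              exact .of_succ hhead fun e he => hA _ (Finset.mem_union_right _
                (Finset.mem_map.2 ⟨e, by simpa using he, rfl⟩))
            · exact hA b (Finset.mem_union_left _ (Finset.mem_erase.2 ⟨hba, hb⟩))
          · refine (C.responseSpan_le t (W := C.responseSpan t (P.erase a)) fun b hb => ?_).trans
              (Submodule.span_mono (Set.image_mono (Finset.coe_subset.2 (P.erase_subset a))))
            rcases Finset.mem_union.1 hb with hb | hb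
            · exact C.response_mem t hb
            · obtain ⟨e, he, rfl⟩ := Finset.mem_map.1 hb
              exact hC a _ hlt hmem e (Finset.mem_filter.1 he).2
        -- An independent `a` joins the blocking set, paid for by the dimension lost on erasing it.
        · obtain ⟨A, hA, hcard⟩ := ih (P.erase a) fun b hb => by
            have := hlt b hb
            omega
          refine ⟨insert a A, fun b hb => ?_, ?_⟩
          · by_cases hba : b = a
            · exact .of_mem (by simp [hba])
            · exact (hA b (Finset.mem_erase.2 ⟨hba, hb⟩)).mono (Finset.subset_insert _ _)
          · have h1 : C.responseSpan t (P.erase a) < C.responseSpan t P := by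
              refine lt_of_le_of_ne
                (Submodule.span_mono (Set.image_mono (Finset.coe_subset.2 (P.erase_subset a))))
                fun h => hmem ?_
              rw [h]
              exact C.response_mem t haP
            have h2 := Submodule.finrank_lt_finrank_of_lt h1
            have h3 := Finset.card_insert_le a A
            omega
      · push Not at hex
        refine ih P fun a ha => ?_
        have h1 := hP a ha
        have h2 := hex a ha
        omega
  exact key (L + 1) P fun a _ => by omega

theorem IsGeneric.independent {C : G.Code F m} {t : V} (hC : C.IsGeneric t)
    (ht : t ∈ G.sinks) {ρ : Finset E} (hρ : m + ρ.card ≤ G.minCut G.source t) :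
    Module.finrank F (C.messageSpace t) = m ∧ C.errorSpace t ρ ⊓ C.messageSpace t = ⊥ := by
  classical
  rw [messageSpace_eq, errorSpace_eq]
  set S : Finset (Fin m ⊕ E) := Finset.univ.map ⟨Sum.inl, Sum.inl_injective⟩ with hS
  set R : Finset (Fin m ⊕ E) := ρ.map ⟨Sum.inr, Sum.inr_injective⟩ with hR
  obtain ⟨A, hA, hcard⟩ := hC.exists_blocked ht (R ∪ S)
  have hSm := C.finrank_responseSpan_le t S
  have hRm := C.finrank_responseSpan_le t R
  rw [hS, Finset.card_map, Finset.card_univ, Fintype.card_fin, ← hS] at hSm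
  rw [hR, Finset.card_map, ← hR] at hRm
  have hsum := Finset.card_toLeft_add_card_toRight (u := A)
  -- If `A` contains all messages, its real channels block `ρ` and hence number at least the
  -- dimension of the span of `R`. Otherwise they form a cut, and there are at least `m + ρ.card` of
  -- them. As `A.card` is at most the dimension of the joint span, the sum of the two spans is then
  -- direct and the message span has dimension `m`.
  have hle : m + Module.finrank F (C.responseSpan t R) ≤ A.card := by
    by_cases hall : ∀ i, Sum.inl i ∈ A
    · have h1 : A.toLeft = Finset.univ := Finset.eq_univ_of_forall fun i => by simpa using hall i
      have h2 : C.responseSpan t R ≤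
          C.responseSpan t (A.toRight.map ⟨Sum.inr, Sum.inr_injective⟩) := by
        refine C.responseSpan_le t fun a ha => ?_
        have hb := hA a (Finset.mem_union_left _ ha)
        obtain ⟨e, he, rfl⟩ := Finset.mem_map.1 ha
        exact C.response_mem_of_blocked (hb.toRight e rfl)
      have h3 := (Submodule.finrank_mono h2).trans (C.finrank_responseSpan_le t _)
      rw [Finset.card_map] at h3
      rw [h1, Finset.card_univ, Fintype.card_fin] at hsum
      omega
    · push Not at hall
      obtain ⟨i, hi⟩ := hall
      have hts : t ≠ G.source := by rintro rfl; exact G.source_notMem_sinks ht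
      have h1 := minCut_le ((hA (Sum.inl i) (Finset.mem_union_right _ (by simp [hS]))).isCut hts hi)
      omega
  rw [responseSpan_union] at hcard
  have hdim := Submodule.finrank_sup_add_finrank_inf_eq (C.responseSpan t R) (C.responseSpan t S)
  refine ⟨by omega, Submodule.finrank_eq_zero.1 (by omega)⟩

/-- The refined Singleton bound, in the form of an error pattern that attains it. -/
theorem exists_errorSpace_inf_ne_bot (C : G.Code F m) {t : V} (ht : t ∈ G.sinks) (hm : 1 ≤ m)
    (hcut : m ≤ G.minCut G.source t) (hreg : Module.finrank F (C.messageSpace t) = m) :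
    ∃ ρ : Finset E, ρ.card + m = G.minCut G.source t + 1 ∧
      C.errorSpace t ρ ⊓ C.messageSpace t ≠ ⊥ := by
  classical
  have hts : G.source ≠ t := by rintro rfl; exact G.source_notMem_sinks ht
  obtain ⟨A, hA, hAcard⟩ := exists_isCut_card_eq_minCut (G := G) hts
  -- Only `m - 1` channels of the minimum cut stay outside `ρ`. The responses to the cut span the
  -- message space, so modulo the error space of `ρ` it has dimension at most `m - 1`.
  obtain ⟨ρ, hρA, hρ⟩ := Finset.exists_subset_card_eq
    (s := A) (n := G.minCut G.source t + 1 - m) (by omega)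
  refine ⟨ρ, by omega, fun hbot => ?_⟩
  have hdim := Submodule.finrank_sup_add_finrank_inf_eq (C.errorSpace t ρ) (C.messageSpace t)
  rw [hbot, finrank_bot, hreg] at hdim
  have h1 : C.errorSpace t ρ ⊔ C.messageSpace t ≤
      C.errorSpace t ρ ⊔ C.errorSpace t (A \ ρ) := by
    refine sup_le le_sup_left ?_
    simp_rw [errorSpace_eq, messageSpace_eq]
    rw [← responseSpan_union, ← Finset.map_union, Finset.union_sdiff_of_subset hρA]
    refine C.responseSpan_le t fun a ha => ?_
    obtain ⟨i, _, rfl⟩ := Finset.mem_map.1 ha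
    exact C.response_mem_of_blocked (hA.blocked i)
  have h2 := Submodule.finrank_mono h1
  have h3 := Submodule.finrank_add_le_finrank_add_finrank
    (C.errorSpace t ρ) (C.errorSpace t (A \ ρ))
  have h4 : Module.finrank F (C.errorSpace t (A \ ρ)) ≤ (A \ ρ).card := by
    rw [errorSpace_eq]
    exact (C.finrank_responseSpan_le t _).trans_eq (Finset.card_map _)
  rw [Finset.card_sdiff_of_subset hρA] at h4
  omega

theorem isMDS_of_isGeneric {C : G.Code F m} (hC : ∀ t ∈ G.sinks, C.IsGeneric t) (hm : 1 ≤ m)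
    (hcut : ∀ t ∈ G.sinks, m ≤ G.minCut G.source t) : C.IsMDS := by
  have hreg : C.IsRegular := fun t ht =>
    ((hC t ht).independent ht (ρ := ∅) (by simpa using hcut t ht)).1
  refine ⟨hreg, fun t ht => ?_⟩
  obtain ⟨ρ, hρ, hne⟩ := C.exists_errorSpace_inf_ne_bot ht hm (hcut t ht) (hreg t ht)
  have hrank : G.patternRank F t ρ ≤ ρ.card := Nat.sInf_le ⟨ρ, fun _ _ => le_rfl, rfl⟩
  have hle : C.minDist t ≤ G.patternRank F t ρ := Nat.sInf_le ⟨ρ, hne, rfl⟩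
  -- Both infima are attained, their sets being nonempty by `ρ` and by reflexivity of domination. A
  -- minimizing pattern `ρ₁` is dominated by some `ρ₂` whose size is the minimum distance; were that
  -- too small, genericity would make the error space of `ρ₂`, hence that of `ρ₁`, meet the message
  -- space trivially.
  have hge : G.minCut G.source t + 1 ≤ C.minDist t + m := by
    obtain ⟨ρ₁, hne₁, hρ₁⟩ := Nat.sInf_mem (s := {r | ∃ ρ : Finset E,
      C.errorSpace t ρ ⊓ C.messageSpace t ≠ ⊥ ∧ G.patternRank F t ρ = r}) ⟨_, ρ, hne, rfl⟩
    obtain ⟨ρ₂, hdom, hρ₂⟩ := Nat.sInf_mem (s := {c | ∃ ρ' : Finset E,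
      G.Dominated F t ρ₁ ρ' ∧ ρ'.card = c}) ⟨_, ρ₁, fun _ _ => le_rfl, rfl⟩
    have hcard : ρ₂.card = C.minDist t := hρ₂.trans hρ₁
    by_contra hlt
    refine hne₁ (le_bot_iff.1 ?_)
    rw [← ((hC t ht).independent ht (ρ := ρ₂) (by omega)).2]
    exact inf_le_inf_right _ (hdom m C)
  omega

end Code

end Network

/-- The hypothesis makes the translates of `B` by the multiples `c • v` pairwise disjoint, one for
each scalar `c`. -/
theorem Nat.card_mul_card_le_of_shift {F X : Type*} [Field F] [Finite F] [AddCommGroup X]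
    [Module F X] [Finite X] (v : X) (B : Set X) (hB : ∀ x ∈ B, ∀ c : F, x + c • v ∈ B → c = 0) :
    B.ncard * Nat.card F ≤ Nat.card X := by
  rw [← Nat.card_coe_set_eq, ← Nat.card_prod]
  refine Nat.card_le_card_of_injective (fun p : B × F => p.1.1 + p.2 • v) ?_
  rintro ⟨⟨x, hx⟩, c⟩ ⟨⟨y, hy⟩, d⟩ h
  have h' : x + c • v = y + d • v := h
  have hy' : y = x + (c - d) • v := by
    rw [sub_smul, ← add_sub_assoc, h', add_sub_cancel_right]
  have hcd := sub_eq_zero.1 (hB x hx (c - d) (hy' ▸ hy))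
  subst hcd
  rw [sub_self, zero_smul, add_zero] at hy'
  subst hy'
  rfl

/-! ### The random method: changing a single coefficient -/

namespace Network

variable {V : Type u} {E : Type v} {G : Network V E} {F : Type w} [Field F] {n : ℕ}

theorem randomFamily_self (x : G.Sample F n) : G.randomFamily x n le_rfl = ⟨x.1.1, x.1.2⟩ :=
  Nat.decreasingInduction_self _ _

theorem randomFamily_of_lt (x : G.Sample F n) {m : ℕ} (hm : m < n) :
    G.randomFamily x m hm.le = (G.randomFamily x (m + 1) hm).reduce (x.2 ⟨m, hm⟩) :=
  Nat.decreasingInduction_succ_left _ _ _ _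

theorem randomFamily_kernel (x : G.Sample F n) {m : ℕ} (hm : m ≤ n) :
    (G.randomFamily x m hm).kernel = x.1.2 := by
  induction hm using Nat.decreasingInduction with
  | self => rw [randomFamily_self]
  | of_succ m hm ih => rw [randomFamily_of_lt x hm, Code.reduce, ih]

/-- Each reduction adds multiples of the last row to the others. Down to dimension `m` the removed
rows have index at least `m`, where `D` vanishes, so a change of the first `m` rows is passed on
unaltered. -/
theorem randomFamily_sourceKernel_of_add {x y : G.Sample F n} {m : ℕ} (hx : y.2 = x.2)
    {D : ℕ → G.Out G.source → F} (hD : ∀ l, m ≤ l → D l = 0)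
    (h : ∀ (i : Fin n) (e), y.1.1 i e = x.1.1 i e + D i e) {l : ℕ} (hl : l ≤ n) (hml : m ≤ l)
    (i : Fin l) (e : G.Out G.source) :
    (G.randomFamily y l hl).sourceKernel i e = (G.randomFamily x l hl).sourceKernel i e + D i e := by
  induction hl using Nat.decreasingInduction with
  | self => rw [randomFamily_self, randomFamily_self]; exact h i e
  | of_succ l hl ih =>
    rw [randomFamily_of_lt y hl, randomFamily_of_lt x hl]
    have h1 := ih (hml.trans l.le_succ) i.castSucc
    have h2 := ih (hml.trans l.le_succ) (Fin.last l)
    simp only [Fin.val_last, hD l hml, Pi.zero_apply, add_zero] at h2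
    simp only [Code.reduce, Matrix.of_apply, h1, h2, hx, Fin.val_castSucc]
    ring

open scoped Classical in
/-- The sample all of whose entries vanish, except for the local encoding coefficient of the
channels `a` and `e`, which is one. -/
noncomputable def singleSample (F : Type w) [Field F] (n : ℕ) {m : ℕ} (a : Fin m ⊕ E) (e : E) :
    G.Sample F n :=
  ((Matrix.of fun i e' =>
      Sum.elim (fun j : Fin m => if (i : ℕ) = j ∧ e' = e then 1 else 0) (fun _ => 0) a,
    fun _ => Matrix.of fun d' e' =>
      Sum.elim (fun _ => 0) (fun d => if d'.1 = d ∧ e'.1 = e then 1 else 0) a), 0)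

open scoped Classical in
-- Thus each coefficient of a derived code can be varied alone, as if it had been chosen
-- independently.
theorem coeff_randomFamily_add_smul (x : G.Sample F n) {m : ℕ} (hm : m ≤ n) {a : Fin m ⊕ E}
    {e : E} (hae : G.Succeeds a e) (c : F) (b : Fin m ⊕ E) (e' : E) :
    (G.randomFamily (x + c • G.singleSample F n a e) m hm).coeff b e' =
      (G.randomFamily x m hm).coeff b e' + if b = a ∧ e' = e then c else 0 := by
  rcases b with i | d
  · have key := randomFamily_sourceKernel_of_add (x := x)
      (y := x + c • G.singleSample F n a e) (m := m)
      (by simp [singleSample])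
      (D := fun l e' => c * Sum.elim (fun j : Fin m => if l = j ∧ e' = e then 1 else 0)
        (fun _ => 0) a)
      (fun l hl => by
        ext e'
        rcases a with j | d
        · have : l ≠ j := (j.2.trans_le hl).ne'
          simp [this]
        · simp)
      (fun i e => rfl) hm le_rfl i
    by_cases h : G.tail e' = G.source
    · simp only [Code.coeff, Sum.elim_inl, h, dif_pos, key]
      rcases a with j | d <;> simp [Fin.ext_iff]
    · have hne : ¬ (Sum.inl i = a ∧ e' = e) := by
        rintro ⟨rfl, rfl⟩
        exact h hae
      simp [Code.coeff, h, hne]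
  · by_cases h : G.head d = G.tail e'
    · simp only [Code.coeff, Sum.elim_inr, h, dif_pos, randomFamily_kernel]
      rcases a with j | d' <;> simp [singleSample]
    · have hne : ¬ (Sum.inr d = a ∧ e' = e) := by
        rintro ⟨rfl, rfl⟩
        exact h hae
      simp [Code.coeff, h, hne]

variable [Fintype E]

theorem response_randomFamily_add_smul (x : G.Sample F n) {m : ℕ} (hm : m ≤ n) {a : Fin m ⊕ E}
    {e : E} (hae : G.Succeeds a e) (c : F) (t : V) {b : Fin m ⊕ E}
    (hb : G.order m a < G.order m b) :
    (G.randomFamily (x + c • G.singleSample F n a e) m hm).response t b =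
      (G.randomFamily x m hm).response t b :=
  Code.response_congr (fun b hb e' => by
    rw [coeff_randomFamily_add_smul x hm hae, if_neg (fun h => hb h.1), add_zero]) t b hb

theorem response_randomFamily_add_smul_self (x : G.Sample F n) {m : ℕ} (hm : m ≤ n)
    {a : Fin m ⊕ E} {e : E} (hae : G.Succeeds a e) (c : F) (t : V) :
    (G.randomFamily (x + c • G.singleSample F n a e) m hm).response t a =
      (G.randomFamily x m hm).response t a
        + c • (G.randomFamily x m hm).response t (Sum.inr e) := by
  classical
  rw [Code.response_eq, Code.response_eq _ t a, add_assoc]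
  congr 1
  have h : ∀ e', (G.randomFamily (x + c • G.singleSample F n a e) m hm).coeff a e' •
      (G.randomFamily (x + c • G.singleSample F n a e) m hm).response t (Sum.inr e') =
      (G.randomFamily x m hm).coeff a e' • (G.randomFamily x m hm).response t (Sum.inr e') +
        if e' = e then c • (G.randomFamily x m hm).response t (Sum.inr e') else 0 := by
    intro e'
    rw [coeff_randomFamily_add_smul x hm hae]
    by_cases he' : G.Succeeds a e'
    · rw [response_randomFamily_add_smul x hm hae c t (G.order_lt he'), add_smul]
      by_cases hee : e' = e <;> simp [hee]
    · have hee : e' ≠ e := by rintro rfl; exact he' hae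
      simp [hee, Code.coeff_eq_zero _ he']
  simp_rw [h, Finset.sum_add_distrib]
  simp

/-! ### Degenerate samples and the union bound -/

/-- The samples for which genericity of the `m`-dimensional code at `t` fails at `a`, `Q`, `e`. -/
def degenerateSamples (F : Type w) [Field F] {n : ℕ} {m : ℕ} (hm : m ≤ n) (t : V)
    (a : Fin m ⊕ E) (Q : Finset (Fin m ⊕ E)) (e : E) : Set (G.Sample F n) :=
  {x | (∀ b ∈ Q, G.order m a < G.order m b) ∧ G.Succeeds a e ∧
    (G.randomFamily x m hm).response t a ∈ (G.randomFamily x m hm).responseSpan t Q ∧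
    (G.randomFamily x m hm).response t (Sum.inr e) ∉ (G.randomFamily x m hm).responseSpan t Q}

/-- Along the line through a sample in the direction of the coefficient from `a` to `e`, the span of
`Q` and the response to `e` are constant. Two degenerate samples at distance `c` on it would put `c`
times the response to `e` into that span, so `c = 0`. -/
theorem ncard_degenerateSamples_mul_le [Finite V] [Finite F] {m : ℕ} (hm : m ≤ n) (t : V)
    (a : Fin m ⊕ E) (Q : Finset (Fin m ⊕ E)) (e : E) :
    (G.degenerateSamples F hm t a Q e).ncard * Nat.card F ≤ Nat.card (G.Sample F n) := by
  refine Nat.card_mul_card_le_of_shift (G.singleSample F n a e) _ ?_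
  rintro x ⟨hQ, hae, ha, he⟩ c ⟨-, -, ha', -⟩
  have hspan : (G.randomFamily (x + c • G.singleSample F n a e) m hm).responseSpan t Q =
      (G.randomFamily x m hm).responseSpan t Q :=
    congrArg (Submodule.span F) (Set.image_congr fun b hb =>
      response_randomFamily_add_smul x hm hae c t (hQ b hb))
  rw [hspan, response_randomFamily_add_smul_self x hm hae, Submodule.add_mem_iff_right _ ha] at ha'
  by_contra hc
  exact he ((Submodule.smul_mem_iff _ hc).1 ha')

theorem isVariableRateMDSFamily_of_notMem {x : G.Sample F n}
    (hcut : ∀ t ∈ G.sinks, n ≤ G.minCut G.source t)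
    (hx : ∀ (m : ℕ) (hm : m ≤ n) (t : V) (a : Fin m ⊕ E) (Q : Finset (Fin m ⊕ E)) (e : E),
      x ∉ G.degenerateSamples F hm t a Q e) :
    G.IsVariableRateMDSFamily (G.randomFamily x) := by
  refine ⟨fun m hm h1 => Code.isMDS_of_isGeneric (fun t _ a Q hQ ha e hae => ?_) h1
    fun t ht => hm.trans (hcut t ht), fun m hm _ i _ _ => ?_⟩
  · by_contra he
    exact hx m hm t a Q e ⟨hQ, hae, ha, he⟩
  · rw [randomFamily_kernel, randomFamily_kernel]

variable (E) in
/-- The places at which a code that the random method makes can fail to be generic. -/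
abbrev Degeneracy (V : Type u) (n : ℕ) : Type (max u v) :=
  Σ m : Fin (n + 1), V × (Fin m ⊕ E) × Finset (Fin m ⊕ E) × E

theorem one_sub_le_successProb [Finite V] [Finite F]
    (hcut : ∀ t ∈ G.sinks, n ≤ G.minCut G.source t) :
    1 - (Nat.card (Degeneracy E V n) : ℝ) / Nat.card F ≤ G.successProb F n := by
  have := Fintype.ofFinite (Degeneracy E V n)
  set S := {x : G.Sample F n | G.IsVariableRateMDSFamily (G.randomFamily x)} with hS
  have hsub : Sᶜ ⊆ ⋃ p : Degeneracy E V n, G.degenerateSamples F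
      (Nat.lt_succ_iff.1 p.1.2) p.2.1 p.2.2.1 p.2.2.2.1 p.2.2.2.2 := by
    intro x hx
    by_contra hx'
    refine hx (isVariableRateMDSFamily_of_notMem hcut fun m hm t a Q e hmem => hx' ?_)
    exact Set.mem_iUnion.2 ⟨⟨⟨m, Nat.lt_succ_iff.2 hm⟩, t, a, Q, e⟩, hmem⟩
  have hbad : Sᶜ.ncard * Nat.card F ≤ Nat.card (Degeneracy E V n) * Nat.card (G.Sample F n) := by
    calc Sᶜ.ncard * Nat.card F
        ≤ (∑ p : Degeneracy E V n, (G.degenerateSamples F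
            (Nat.lt_succ_iff.1 p.1.2) p.2.1 p.2.2.1 p.2.2.2.1 p.2.2.2.2).ncard) * Nat.card F := by
          refine Nat.mul_le_mul_right _ ((Set.ncard_le_ncard hsub (Set.toFinite _)).trans ?_)
          exact Set.ncard_iUnion_le_of_fintype _
      _ ≤ ∑ _p : Degeneracy E V n, Nat.card (G.Sample F n) := by
          rw [Finset.sum_mul]
          exact Finset.sum_le_sum fun p _ => ncard_degenerateSamples_mul_le _ _ _ _ _
      _ = _ := by simp [Nat.card_eq_fintype_card]
  have hX : (0 : ℝ) < Nat.card (G.Sample F n) := by exact_mod_cast Nat.card_pos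
  have hq : (0 : ℝ) < Nat.card F := by exact_mod_cast Nat.card_pos
  have hcompl : (S.ncard : ℝ) + Sᶜ.ncard = Nat.card (G.Sample F n) := by
    exact_mod_cast Set.ncard_add_ncard_compl S
  have hbad' : (Sᶜ.ncard : ℝ) * Nat.card F ≤
      Nat.card (Degeneracy E V n) * Nat.card (G.Sample F n) := by exact_mod_cast hbad
  rw [successProb, ← hS, le_div_iff₀ hX, sub_mul, one_mul, sub_le_comm, ← hcompl,
    add_sub_cancel_left, hcompl, div_mul_eq_mul_div, le_div_iff₀ hq]
  exact hbad'

end Network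

theorem mainTheorem6 {V : Type u} {E : Type v} [Finite V] [Fintype E] (G : Network V E)
    (ω : ℕ) (hω : 1 ≤ ω) (hcut : ∀ t ∈ G.sinks, ω ≤ G.minCut G.source t)
    (ε : ℝ) (hε : 0 < ε) :
    ∃ q₀ : ℕ, ∀ (F : Type w) [Field F] [Finite F], q₀ ≤ Nat.card F →
      1 - ε ≤ G.successProb F ω := by
  -- The failure probability is at most the number of places of degeneracy over `|F|`; this `q₀`
  -- brings it down to `ε`.
  refine ⟨⌈(Nat.card (Network.Degeneracy E V ω) : ℝ) / ε⌉₊, fun F _ _ hF => ?_⟩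
  refine le_trans (sub_le_sub_left ?_ 1) (Network.one_sub_le_successProb hcut)
  have hq : (0 : ℝ) < Nat.card F := by exact_mod_cast Nat.card_pos
  rw [div_le_comm₀ hq hε]
  exact Nat.ceil_le.1 hF
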